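/- **Model.** An input consists of finitely many jobs. Job $q$ has a release time $r_q\ge 0$, a processing time $p_q>0$ and an estimate $\tilde p_q>0$. Put $\mu_1=\max(1,\max_q p_q/\tilde p_q)$ and $\mu_2=\max(1,\max_q \tilde p_q/p_q)$; the distortion of the input is $\mu_1\mu_2$. The jobs are scheduled preemptively on a single machine of unit speed, and no job is processed before its release; job $q$ is completed at the time $C_q\in[0,\infty]$ at which it has received $p_q$ units of processing. The total flow time of a schedule is $\sum_q (C_q-r_q)$, and $\mathrm{OPT}(I)$ is the infimum of the total flow times of all schedules for $I$ that process at most one job at a time. A deterministic online algorithm assigns to every input a schedule, where the decision at time $t$ depends only on what has been observed during $[0,t]$: which jobs have been released (with their release times and estimates, but not their processing times), and which of these have been completed, and when. It may share the machine among several jobs (at each time the jobs receive nonnegative rates of total at most $1$), and it may idle. A randomized online algorithm is a random deterministic online algorithm. An algorithm is $\rho$-competitive on a class of inputs if for some constant $b\ge 0$ its (expected) total flow time $\mathrm{ALG}(I)$ satisfies $\mathrm{ALG}(I)\le\rho\cdot\mathrm{OPT}(I)+b$ for all inputs $I$ in the class. **Theorem.** There is an absolute constant $c>0$ such that for every $\mu\ge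 1$, every randomized (and hence every deterministic) online algorithm that is $\rho$-competitive on the inputs of distortion at most $\mu$ satisfies $\rho\ge c\mu$. (The algorithm may depend on $\mu$.) -/

import Mathlib

open MeasureTheory
open scoped ENNReal NNReal

noncomputable section

namespace FlowTime

/-- A job: its release time, the estimate of its processing time that is announced on release,
and its real processing time. -/
structure Job where
  release : ℝ
  est : ℝ
  proc : ℝ
  release_nonneg : 0 ≤ release
  est_pos : 0 < est
  proc_pos : 0 < proc

/-- An input: finitely many jobs, numbered in order of arrival (so that the number of a job
carries no information about the future). -/
structure Instance where
  n : ℕ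
  job : Fin n → Job
  sorted : Monotone fun i => (job i).release

namespace Instance

/-- The maximum real-to-estimated ratio, set to `1` if it is smaller than `1`. -/
def underestimation (I : Instance) : ℝ := max 1 (⨆ i, (I.job i).proc / (I.job i).est)

/-- The maximum estimated-to-real ratio, set to `1` if it is smaller than `1`. -/
def overestimation (I : Instance) : ℝ := max 1 (⨆ i, (I.job i).est / (I.job i).proc)

def distortion (I : Instance) : ℝ := I.underestimation * I.overestimation

end Instance

/-- A preemptive schedule on a single machine of unit speed: `rate i t` is the share of the machine
given to job `i` at time `t`. A job is not processed before its release. Idling is allowed, and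
processing a job after its completion is the same as idling. -/
structure Schedule (I : Instance) where
  rate : Fin I.n → ℝ → ℝ
  measurable_rate : ∀ i, Measurable (rate i)
  rate_nonneg : ∀ i t, 0 ≤ rate i t
  sum_rate_le : ∀ t, ∑ i, rate i t ≤ 1
  rate_eq_zero : ∀ i t, t < (I.job i).release → rate i t = 0

namespace Schedule

variable {I : Instance}

/-- The schedule never shares the machine: at each time it works on at most one job, at full
speed. (At most one rate can be `1`, since the rates add up to at most `1`.) -/
def Sequential (S : Schedule I) : Prop := ∀ i t, S.rate i t = 0 ∨ S.rate i t = 1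

/-- The processing that job `i` has received up to time `t`. -/
def work (S : Schedule I) (i : Fin I.n) (t : ℝ) : ℝ := ∫ s in (0 : ℝ)..t, S.rate i s

def Completed (S : Schedule I) (i : Fin I.n) (t : ℝ) : Prop := (I.job i).proc ≤ S.work i t

/-- The completion time of job `i`; it is `∞` if the job is never completed. -/
def completionTime (S : Schedule I) (i : Fin I.n) : ℝ≥0∞ :=
  ⨅ (t : ℝ) (_ : 0 ≤ t ∧ S.Completed i t), ENNReal.ofReal t

/-- The total flow time. -/
def flowTime (S : Schedule I) : ℝ≥0∞ :=
  ∑ i, (S.completionTime i - ENNReal.ofReal (I.job i).release)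

/-- What can be seen at time `t` of the `k`-th job: nothing before its release; afterwards its
release time, its estimate, and whether it has been completed. -/
def view (S : Schedule I) (t : ℝ) (k : ℕ) : Option (ℝ × ℝ × Prop) :=
  if h : k < I.n then
    if (I.job ⟨k, h⟩).release ≤ t then
      some ((I.job ⟨k, h⟩).release, (I.job ⟨k, h⟩).est, S.Completed ⟨k, h⟩ t)
    else none
  else none

end Schedule

/-- The optimal (offline) total flow time, over the schedules that run one job at a time. -/
def opt (I : Instance) : ℝ≥0∞ := ⨅ (S : Schedule I) (_ : S.Sequential), S.flowTime

/-- A deterministic online algorithm: the decision at time `t` depends only on what has been seen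
during `[0, t]`. -/
structure OnlineAlgorithm where
  schedule : ∀ I : Instance, Schedule I
  nonanticipating : ∀ (I I' : Instance) (t : ℝ), 0 ≤ t →
    (∀ s : ℝ, 0 ≤ s → s ≤ t → ∀ k : ℕ, (schedule I).view s k = (schedule I').view s k) →
    ∀ (k : ℕ) (h : k < I.n) (h' : k < I'.n),
      (schedule I).rate ⟨k, h⟩ t = (schedule I').rate ⟨k, h'⟩ t

def OnlineAlgorithm.cost (A : OnlineAlgorithm) (I : Instance) : ℝ≥0∞ := (A.schedule I).flowTime

/-- `A` is `ρ`-competitive on inputs of distortion at most `μ`, up to an additive constant. -/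
def OnlineAlgorithm.IsCompetitive (A : OnlineAlgorithm) (μ : ℝ) (ρ : ℝ≥0) : Prop :=
  ∃ b : ℝ≥0, ∀ I : Instance, I.distortion ≤ μ → A.cost I ≤ ρ * opt I + b

/-- A randomized online algorithm: a random deterministic one, whose cost on each input is a random
variable. -/
structure RandomizedAlgorithm {Ω : Type*} [MeasurableSpace Ω] (P : Measure Ω) where
  alg : Ω → OnlineAlgorithm
  aemeasurable_cost : ∀ I : Instance, AEMeasurable (fun ω => (alg ω).cost I) P

/-- The expected cost. -/
def RandomizedAlgorithm.cost {Ω : Type*} [MeasurableSpace Ω] {P : Measure Ω}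
    (A : RandomizedAlgorithm P) (I : Instance) : ℝ≥0∞ := ∫⁻ ω, (A.alg ω).cost I ∂P

/-- `A` is `ρ`-competitive in expectation on inputs of distortion at most `μ`, up to an additive
constant. -/
def RandomizedAlgorithm.IsCompetitive {Ω : Type*} [MeasurableSpace Ω] {P : Measure Ω}
    (A : RandomizedAlgorithm P) (μ : ℝ) (ρ : ℝ≥0) : Prop :=
  ∃ b : ℝ≥0, ∀ I : Instance, I.distortion ≤ μ → A.cost I ≤ ρ * opt I + b

end FlowTime

end

/-! The bound comes from a random input, as in Yao's principle. At time 0 there are `n = K * 2 ^ (d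
+ 1)` jobs, all of estimate 1, whose sizes are independent geometric variables truncated at `d + 1`.
From time `T` on, a long stream of `L` unit jobs keeps the machine busy; `T` falls short of the
expected total size by `K * (d + 1)`.

Online: at every integer time of the stream, the expected unfinished volume is at least `K * (d +
1)` (`sub_le_sum_alive`). The sizes are memoryless, so an unfinished job has expected remaining size
at most 2 (`sum_remaining_le`, transferred to algorithms by `OnlineAlgorithm.work_eq_work`). Hence
at least `K * (d + 1) / 2` jobs are unfinished on average (`sum_cost_ge`).

Offline: only `2 * K` jobs are expected to have the maximal size `d + 1`, yet their volume `2 * K *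
(d + 1)` is twice the deficit. The others fit in before `T` except with small probability, by
Chebyshev (`card_overfull_le`), and the jobs of maximal size wait until the stream is over. With `K
= 4 ^ (d + 1)`, on average at most `4 * K` jobs wait during the stream. As `L` grows, all other
costs become negligible, which gives the ratio `(d + 1) / 8`. -/

namespace FlowTime

/-! ### Work and flow time of a schedule -/

namespace Schedule

variable {I : Instance} (S : Schedule I)

lemma rate_le_one (i : Fin I.n) (t : ℝ) : S.rate i t ≤ 1 :=
  (Finset.single_le_sum (fun j _ => S.rate_nonneg j t) (Finset.mem_univ i)).trans (S.sum_rate_le t)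

lemma intervalIntegrable_rate (i : Fin I.n) (a b : ℝ) :
    IntervalIntegrable (S.rate i) volume a b := by
  refine (intervalIntegrable_const (c := (1 : ℝ))).mono_fun
    (S.measurable_rate i).aestronglyMeasurable (Filter.Eventually.of_forall fun t => ?_)
  simp only [Real.norm_eq_abs, abs_of_nonneg (S.rate_nonneg i t), abs_one]
  exact S.rate_le_one i t

lemma continuous_work (i : Fin I.n) : Continuous (S.work i) :=
  intervalIntegral.continuous_primitive (fun a b => S.intervalIntegrable_rate i a b) 0

lemma work_mono (i : Fin I.n) : Monotone (S.work i) := by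
  intro a b hab
  have h := intervalIntegral.integral_interval_sub_left (S.intervalIntegrable_rate i 0 b)
    (S.intervalIntegrable_rate i 0 a)
  have h' : 0 ≤ ∫ s in a..b, S.rate i s :=
    intervalIntegral.integral_nonneg hab fun t _ => S.rate_nonneg i t
  simp only [work]
  linarith

lemma work_nonneg (i : Fin I.n) {t : ℝ} (ht : 0 ≤ t) : 0 ≤ S.work i t :=
  intervalIntegral.integral_nonneg ht fun s _ => S.rate_nonneg i s

lemma sum_work_le {t : ℝ} (ht : 0 ≤ t) : ∑ i, S.work i t ≤ t := by
  simp only [work]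
  rw [← intervalIntegral.integral_finsetSum fun i _ => S.intervalIntegrable_rate i 0 t]
  have hint : IntervalIntegrable (fun s => ∑ i, S.rate i s) volume 0 t := by
    simpa only [Finset.sum_fn] using IntervalIntegrable.sum (f := S.rate) Finset.univ
      (fun i _ => S.intervalIntegrable_rate i 0 t)
  calc ∫ s in (0 : ℝ)..t, ∑ i, S.rate i s ≤ ∫ _s in (0 : ℝ)..t, (1 : ℝ) :=
        intervalIntegral.integral_mono_on ht hint intervalIntegrable_const
          (fun s _ => S.sum_rate_le s)
    _ = t := by simp


lemma Completed.mono {S : Schedule I} {i : Fin I.n} {s t : ℝ} (h : S.Completed i s)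
    (hst : s ≤ t) : S.Completed i t := le_trans h (S.work_mono i hst)

lemma le_completionTime {i : Fin I.n} {t : ℝ} (h : ¬ S.Completed i t) :
    ENNReal.ofReal t ≤ S.completionTime i := by
  refine le_iInf₂ fun t' ht' => ENNReal.ofReal_le_ofReal ?_
  by_contra! hlt
  exact h (ht'.2.mono hlt.le)

/-- Every unit interval at whose end the job is still unfinished adds one to its flow time. -/
lemma card_le_flow {i : Fin I.n} {r : ℕ} (hr : (I.job i).release = r) (F : Finset ℕ)
    (hF : ∀ l ∈ F, r < l ∧ ¬ S.Completed i l) :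
    (F.card : ℝ≥0∞) ≤ S.completionTime i - ENNReal.ofReal (I.job i).release := by
  rcases F.eq_empty_or_nonempty with rfl | hne
  · simp
  have hmax := hF _ (F.max'_mem hne)
  have hcard : F.card ≤ F.max' hne - r := by
    rw [← Nat.card_Ioc]
    exact Finset.card_le_card fun l hl => Finset.mem_Ioc.2 ⟨(hF l hl).1, F.le_max' l hl⟩
  have hC := S.le_completionTime hmax.2
  rw [hr, ENNReal.ofReal_natCast]
  rw [ENNReal.ofReal_natCast] at hC
  refine le_trans ?_ (tsub_le_tsub_right hC _)
  rw [← ENNReal.natCast_sub]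
  exact_mod_cast hcard

end Schedule

/-! ### Indistinguishable inputs -/

/-- A job that has received less than `c` units of processing is treated in the same way whatever
its processing time is, as long as that is at least `c`. -/
lemma OnlineAlgorithm.work_eq_work (A : OnlineAlgorithm) {N : ℕ} {J J' : Fin N → Job}
    (hs : Monotone fun k => (J k).release) (hs' : Monotone fun k => (J' k).release) (i : Fin N)
    (hrel : ∀ k, (J k).release = (J' k).release) (hest : ∀ k, (J k).est = (J' k).est)
    (hproc : ∀ k, k ≠ i → (J k).proc = (J' k).proc) {c t : ℝ} (ht : 0 ≤ t)
    (hc : c ≤ (J i).proc) (hc' : c ≤ (J' i).proc)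
    (hw : (A.schedule ⟨N, J, hs⟩).work i t < c) :
    (A.schedule ⟨N, J', hs'⟩).work i t = (A.schedule ⟨N, J, hs⟩).work i t := by
  set S := A.schedule ⟨N, J, hs⟩ with hS
  set S' := A.schedule ⟨N, J', hs'⟩ with hS'
  -- Continuous induction on the times before which both runs have seen the same completions. The
  -- strict bound `u < s` makes `G` closed, and it still determines the work up to `s`, since one
  -- instant has measure zero.
  let G : Set ℝ := {s | ∀ u, 0 ≤ u → u < s → ∀ k : Fin N, S.Completed k u ↔ S'.Completed k u}
  have hG : IsClosed G := by
    have : G = ⋂ (u : ℝ) (_ : 0 ≤ u) (_ : ¬ ∀ k : Fin N, S.Completed k u ↔ S'.Completed k u),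
        Set.Iic u := by
      ext s
      simp only [G, Set.mem_ofPred_eq, Set.mem_iInter, Set.mem_Iic]
      exact forall₂_congr fun u _ => ⟨fun h hn => not_lt.1 fun hlt => hn (h hlt),
        fun h hlt => by by_contra hn; exact absurd (h hn) (not_le.2 hlt)⟩
    rw [this]
    exact isClosed_iInter fun u => isClosed_iInter fun _ => isClosed_iInter fun _ => isClosed_Iic
  have hwork : ∀ s ∈ G, 0 ≤ s → ∀ k : Fin N, S'.work k s = S.work k s := by
    intro s hsG h0 k
    have hrate : ∀ u, 0 ≤ u → u < s → S'.rate k u = S.rate k u := by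
      intro u hu hus
      refine (A.nonanticipating ⟨N, J, hs⟩ ⟨N, J', hs'⟩ u hu ?_ k k.2 k.2).symm
      intro v hv hvu l
      by_cases hl : l < N
      · have hiff := propext (hsG v hv (hvu.trans_lt hus) ⟨l, hl⟩)
        simp only [Schedule.view, hl, dif_pos, hrel, hest]
        rw [← hS, ← hS', hiff]
      · simp [Schedule.view, hl]
    simp only [Schedule.work]
    refine intervalIntegral.integral_congr_ae ?_
    have hne : ∀ᵐ u : ℝ, u ≠ s := by simp [ae_iff]
    filter_upwards [hne] with u hu hmem
    rw [Set.uIoc_of_le h0] at hmem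
    exact hrate u hmem.1.le (lt_of_le_of_ne hmem.2 hu)
  have hsub : Set.Icc 0 t ⊆ G := by
    refine IsClosed.Icc_subset_of_forall_exists_gt (hG.inter isClosed_Icc)
      (fun u h0 hu => absurd hu (not_lt.2 h0)) ?_
    rintro s ⟨hsG, h0, hst⟩ y hy
    have hbelow : ∀ (R : Schedule ⟨N, J, hs⟩) (k : Fin N) (b : ℝ), R.work k s < b →
        ∀ᶠ u in nhdsWithin s (Set.Ioi s), R.work k u < b := fun R k b hb =>
      (((R.continuous_work k).tendsto s).eventually (gt_mem_nhds hb)).filter_mono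
        nhdsWithin_le_nhds
    have hbelow' : ∀ (R : Schedule ⟨N, J', hs'⟩) (k : Fin N) (b : ℝ), R.work k s < b →
        ∀ᶠ u in nhdsWithin s (Set.Ioi s), R.work k u < b := fun R k b hb =>
      (((R.continuous_work k).tendsto s).eventually (gt_mem_nhds hb)).filter_mono
        nhdsWithin_le_nhds
    have hev : ∀ k : Fin N, ∀ᶠ u in nhdsWithin s (Set.Ioi s), ∀ v, s ≤ v → v ≤ u →
        (S.Completed k v ↔ S'.Completed k v) := by
      intro k
      -- A job unfinished in both runs at time `s` stays so for a while, by continuity of the work.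
      -- The job `i` is always of this kind, as its work is below `c`; any other job has the same
      -- size in both inputs, so otherwise it is completed in both.
      by_cases hk : S.work k s < (J k).proc ∧ S'.work k s < (J' k).proc
      · filter_upwards [hbelow S k _ hk.1, hbelow' S' k _ hk.2] with u hu hu' v _ hvu
        exact iff_of_false (not_le.2 ((S.work_mono k hvu).trans_lt hu))
          (not_le.2 ((S'.work_mono k hvu).trans_lt hu'))
      · have hki : k ≠ i := by
          rintro rfl
          have := (S.work_mono k hst.le).trans_lt hw
          exact hk ⟨this.trans_le hc, (hwork s hsG h0 k).trans_lt (this.trans_le hc')⟩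
        have hcomp : S.Completed k s ∧ S'.Completed k s := by
          rw [hwork s hsG h0 k, ← hproc k hki, and_self, not_lt] at hk
          exact ⟨hk, by
            simpa only [Schedule.Completed, hwork s hsG h0 k, ← hproc k hki] using hk⟩
        exact Filter.Eventually.of_forall fun u v hv _ =>
          iff_of_true (hcomp.1.mono hv) (hcomp.2.mono hv)
    have hIoc : ∀ᶠ u in nhdsWithin s (Set.Ioi s), u ∈ Set.Ioc s y := Ioc_mem_nhdsGT hy
    obtain ⟨u, hu, hu'⟩ := ((Filter.eventually_all.2 hev).and hIoc).exists
    refine ⟨u, fun v hv hvu k => ?_, hu'⟩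
    rcases lt_or_ge v s with hvs | hvs
    · exact hsG v hv hvs k
    · exact hu k v hvs hvu.le
  exact hwork t (hsub ⟨ht, le_rfl⟩) ht i

/-! ### Bounding the optimum by slot schedules -/

/-- A schedule that gives the job `i` the unit time slots in `Q i`. -/
noncomputable def slotSchedule (I : Instance) (Q : Fin I.n → Finset ℕ)
    (hQ : Pairwise fun i j => Disjoint (Q i) (Q j))
    (hr : ∀ i, ∀ s ∈ Q i, (I.job i).release ≤ s) : Schedule I where
  -- The floor `⌊t⌋₊` is 0 for negative `t`, so without `0 ≤ t` slot 0 would extend to all negative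
  -- times.
  rate i t := if 0 ≤ t ∧ ⌊t⌋₊ ∈ Q i then 1 else 0
  measurable_rate i := Measurable.ite
    (measurableSet_Ici.inter (Nat.measurable_floor (Q i).measurableSet))
    measurable_const measurable_const
  rate_nonneg i t := by split_ifs <;> norm_num
  sum_rate_le t := by
    by_cases h : ∃ i, ⌊t⌋₊ ∈ Q i
    · obtain ⟨i, hi⟩ := h
      rw [Finset.sum_eq_single i]
      · split_ifs <;> norm_num
      · intro j _ hj
        rw [if_neg]
        exact fun h => Finset.disjoint_left.1 (hQ hj) h.2 hi
      · simp
    · push Not at h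
      simp [h]
  rate_eq_zero i t ht := by
    rw [if_neg]
    rintro ⟨h0, h⟩
    exact absurd ht (not_lt.2 ((hr i _ h).trans (Nat.floor_le h0)))

lemma le_work_slotSchedule {I : Instance} {Q : Fin I.n → Finset ℕ}
    (hQ : Pairwise fun i j => Disjoint (Q i) (Q j))
    (hr : ∀ i, ∀ s ∈ Q i, (I.job i).release ≤ s) (i : Fin I.n) (D : ℕ) (hD : ∀ s ∈ Q i, s < D) :
    ((Q i).card : ℝ) ≤ (slotSchedule I Q hQ hr).work i D := by
  set S := slotSchedule I Q hQ hr
  have hunit : ∀ s : ℕ, ∫ u in (s : ℝ)..((s + 1 : ℕ) : ℝ), S.rate i u =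
      if s ∈ Q i then 1 else 0 := by
    intro s
    have hne : ∀ᵐ u : ℝ, u ≠ ((s + 1 : ℕ) : ℝ) := by simp [ae_iff]
    have hle : (s : ℝ) ≤ ((s + 1 : ℕ) : ℝ) := by push_cast; linarith
    rw [intervalIntegral.integral_congr_ae (g := fun _ => if s ∈ Q i then (1 : ℝ) else 0)]
    · simp
    · filter_upwards [hne] with u hu hmem
      rw [Set.uIoc_of_le hle] at hmem
      have h0 : 0 ≤ u := (Nat.cast_nonneg s).trans hmem.1.le
      have hfl : ⌊u⌋₊ = s := by
        rw [Nat.floor_eq_iff h0]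
        exact ⟨hmem.1.le, by exact_mod_cast lt_of_le_of_ne hmem.2 hu⟩
      simp [S, slotSchedule, h0, hfl]
  have hsum := intervalIntegral.sum_integral_adjacent_intervals (μ := volume) (f := S.rate i)
    (a := fun s : ℕ => (s : ℝ)) (n := D) (fun k _ => S.intervalIntegrable_rate i _ _)
  rw [Nat.cast_zero] at hsum
  rw [Schedule.work, ← hsum, Finset.sum_congr rfl fun s _ => hunit s, ← Finset.sum_filter,
    Finset.sum_const, nsmul_one]
  exact_mod_cast Finset.card_le_card fun s hs =>
    Finset.mem_filter.2 ⟨Finset.mem_range.2 (hD s hs), hs⟩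

lemma opt_le_sum {I : Instance} (p r D : Fin I.n → ℕ) (hp : ∀ i, (I.job i).proc = p i)
    (hrel : ∀ i, (I.job i).release = r i) (Q : Fin I.n → Finset ℕ)
    (hQ : Pairwise fun i j => Disjoint (Q i) (Q j)) (hcard : ∀ i, p i ≤ (Q i).card)
    (hr : ∀ i, ∀ s ∈ Q i, r i ≤ s) (hD : ∀ i, ∀ s ∈ Q i, s < D i) :
    opt I ≤ ((∑ i, (D i - r i) : ℕ) : ℝ≥0∞) := by
  have hr' : ∀ i, ∀ s ∈ Q i, (I.job i).release ≤ s := fun i s hs => by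
    rw [hrel]; exact_mod_cast hr i s hs
  refine iInf₂_le_of_le (slotSchedule I Q hQ hr') (fun i t => ?_) ?_
  · simp only [slotSchedule]
    split_ifs <;> simp
  · rw [Nat.cast_sum]
    refine Finset.sum_le_sum fun i _ => ?_
    rw [hrel, ENNReal.ofReal_natCast, ENNReal.natCast_sub]
    refine tsub_le_tsub_right ?_ _
    refine (iInf₂_le (D i : ℝ) ⟨Nat.cast_nonneg _, ?_⟩).trans (by simp)
    refine le_trans ?_ (le_work_slotSchedule hQ hr' i (D i) (hD i))
    rw [hp]
    exact_mod_cast hcard i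

/-- Disjoint sets of time slots, of prescribed cardinalities, after time `c`. -/
lemma exists_slots {ι : Type*} [DecidableEq ι] (p : ι → ℕ) (c : ℕ) (F : Finset ι) :
    ∃ Q : ι → Finset ℕ, (∀ i ∈ F, (Q i).card = p i ∧ Q i ⊆ Finset.Ico c (c + ∑ i ∈ F, p i)) ∧
      (F : Set ι).PairwiseDisjoint Q := by
  induction F using Finset.induction_on with
  | empty => exact ⟨fun _ => ∅, by simp, by simp⟩
  | insert i F hi ih =>
    obtain ⟨Q, hQ, hdisj⟩ := ih
    have hne : ∀ j ∈ F, j ≠ i := fun j hj h => hi (h ▸ hj)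
    refine ⟨Function.update Q i (Finset.Ico (c + ∑ i ∈ F, p i) (c + ∑ i ∈ F, p i + p i)), ?_, ?_⟩
    · intro j hj
      rw [Finset.sum_insert hi]
      rcases Finset.mem_insert.1 hj with rfl | hj
      · rw [Function.update_self, Nat.card_Ico]
        exact ⟨by omega, Finset.Ico_subset_Ico (by omega) (by omega)⟩
      · rw [Function.update_of_ne (hne j hj)]
        exact ⟨(hQ j hj).1, (hQ j hj).2.trans (Finset.Ico_subset_Ico le_rfl (by omega))⟩
    · rw [Finset.coe_insert, Set.pairwiseDisjoint_insert_of_notMem (by simpa using hi)]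
      refine ⟨fun j hj k hk hjk => ?_, fun j hj => ?_⟩
      · simp only [Function.onFun, Function.update_of_ne (hne j hj),
          Function.update_of_ne (hne k hk)]
        exact hdisj hj hk hjk
      · rw [Function.update_self, Function.update_of_ne (hne j hj)]
        refine Finset.disjoint_left.2 fun s hs hs' => ?_
        have := Finset.mem_Ico.1 ((hQ j hj).2 hs')
        have := Finset.mem_Ico.1 hs
        omega

/-! ### Truncated geometric sizes -/

/-- A truncated geometric size: for `a` uniform below `2 ^ d`, it is at least `j + 1` with
probability `2 ^ (-j)`, for each `j ≤ d`. -/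
def geomSize (d a : ℕ) : ℕ := d - Nat.size a + 1

/-- Induction on the top bit: the upper half of the range has size 1, and on the lower half raising
`s` by one adds 1 to the size. The mean is thus just below 2. -/
lemma sum_geomSize (s : ℕ) : ∑ a ∈ Finset.range (2 ^ s), geomSize s a = 2 ^ (s + 1) - 1 := by
  induction s with
  | zero => simp [geomSize]
  | succ s ih =>
    rw [pow_succ 2 s, mul_two, Finset.sum_range_add]
    have h1 : ∑ a ∈ Finset.range (2 ^ s), geomSize (s + 1) a =
        ∑ a ∈ Finset.range (2 ^ s), (geomSize s a + 1) := by
      refine Finset.sum_congr rfl fun a ha => ?_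
      have := Nat.size_le.2 (Finset.mem_range.1 ha)
      simp only [geomSize]
      omega
    have h2 : ∑ a ∈ Finset.range (2 ^ s), geomSize (s + 1) (2 ^ s + a) =
        ∑ a ∈ Finset.range (2 ^ s), 1 := by
      refine Finset.sum_congr rfl fun a _ => ?_
      have : s < Nat.size (2 ^ s + a) := Nat.lt_size.2 (by omega)
      simp only [geomSize]
      omega
    rw [h1, h2, Finset.sum_add_distrib, ih]
    have : 1 ≤ 2 ^ s := Nat.one_le_two_pow
    simp only [Finset.sum_const, Finset.card_range, smul_eq_mul, mul_one, pow_succ]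
    omega

/-- The size is memoryless: if work stops at a moment that depends on the size only through what
has been observed, then the expected remaining size is at most twice the probability that
something remains. -/
lemma sum_remaining_le (d : ℕ) (g : Fin (2 ^ d) → ℝ) (hg0 : ∀ a, 0 ≤ g a)
    (hg : ∀ (j : ℕ) (a a' : Fin (2 ^ d)), g a < j → j ≤ geomSize d a → j ≤ geomSize d a' → g a' < j) :
    ∑ a : Fin (2 ^ d), max 0 ((geomSize d a : ℝ) - g a) ≤ ∑ a : Fin (2 ^ d), if g a < geomSize d a then (2 : ℝ) else 0 := by
  classical
  -- For the least such `j`, the work lies in `[j - 1, j)` for all sizes at least `j`, and all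
  -- smaller sizes are finished. If there is no such `j`, nothing remains for any size.
  by_cases hex : ∃ j : ℕ, ∃ a : Fin (2 ^ d), g a < j ∧ j ≤ geomSize d a
  swap
  · push Not at hex
    refine Finset.sum_le_sum fun a _ => ?_
    have h : ¬ g a < geomSize d a := fun h => absurd (hex _ a h) (by simp)
    rw [if_neg h, max_le_iff]
    exact ⟨le_rfl, by linarith⟩
  obtain ⟨a₀, ha₀, ha₀'⟩ := Nat.find_spec hex
  set j := Nat.find hex with hj
  have hj1 : 1 ≤ j := by
    rcases Nat.eq_zero_or_pos j with h | h
    · rw [h, Nat.cast_zero] at ha₀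
      exact absurd ha₀ (not_lt.2 (hg0 a₀))
    · exact h
  have hjd : j ≤ d + 1 := ha₀'.trans (by simp [geomSize])
  have hlt : ∀ a : Fin (2 ^ d), j ≤ geomSize d a → g a < geomSize d a := fun a h =>
    (hg j a₀ a ha₀ ha₀' h).trans_le (by exact_mod_cast h)
  have hge : ∀ a : Fin (2 ^ d), j ≤ geomSize d a → (j : ℝ) - 1 ≤ g a := by
    intro a h
    rcases hj1.eq_or_lt with h1 | h1
    · rw [← h1]
      simpa using hg0 a
    · by_contra! hlt'
      refine Nat.find_min hex (m := j - 1) (by omega) ⟨a, ?_, by omega⟩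
      rw [Nat.cast_sub hj1, Nat.cast_one]
      exact hlt'
  have hle : ∀ a : Fin (2 ^ d), ¬ j ≤ geomSize d a → ¬ g a < geomSize d a := fun a h h' =>
    h (Nat.find_min' hex ⟨a, h', le_rfl⟩)
  -- The sizes at least `j` belong to `a < 2 ^ s`, and there `geomSize d a - (j - 1)` equals
  -- `geomSize s a`: this is the memoryless property.
  obtain ⟨s, hs⟩ : ∃ s, d + 1 = j + s := ⟨d + 1 - j, by omega⟩
  have hiff : ∀ a : Fin (2 ^ d), j ≤ geomSize d a ↔ (a : ℕ) < 2 ^ s := by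
    intro a
    have := Nat.size_le.2 a.2
    rw [← Nat.size_le, geomSize]
    omega
  have hsd : 2 ^ s ≤ 2 ^ d := Nat.pow_le_pow_right (by norm_num) (by omega)
  have hfilter : (Finset.range (2 ^ d)).filter (fun a => a < 2 ^ s) = Finset.range (2 ^ s) := by
    ext a
    simp only [Finset.mem_filter, Finset.mem_range]
    omega
  calc ∑ a : Fin (2 ^ d), max 0 ((geomSize d a : ℝ) - g a)
      ≤ ∑ a : Fin (2 ^ d), (if (a : ℕ) < 2 ^ s then (geomSize s a : ℝ) else 0) := by
        refine Finset.sum_le_sum fun a _ => ?_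
        split_ifs with h
        · refine max_le (Nat.cast_nonneg _) ?_
          have h1 := hge a ((hiff a).2 h)
          have h2 : geomSize d a + 1 = j + geomSize s a := by
            have := Nat.size_le.2 h
            simp only [geomSize]
            omega
          have h3 : (geomSize d a : ℝ) + 1 = j + geomSize s a := by exact_mod_cast h2
          linarith
        · have := hle a (mt (hiff a).1 h)
          exact max_le le_rfl (by linarith)
    _ = ∑ a ∈ Finset.range (2 ^ s), (geomSize s a : ℝ) := by
        rw [Fin.sum_univ_eq_sum_range (fun a => if a < 2 ^ s then (geomSize s a : ℝ) else 0),
          ← Finset.sum_filter, hfilter]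
    _ ≤ ∑ a ∈ Finset.range (2 ^ s), 2 := by
        rw [← Nat.cast_sum, sum_geomSize]
        have : 2 ^ (s + 1) - 1 ≤ 2 ^ s * 2 := by rw [pow_succ]; omega
        simpa using (by exact_mod_cast this : ((2 ^ (s + 1) - 1 : ℕ) : ℝ) ≤ 2 ^ s * 2)
    _ = ∑ a : Fin (2 ^ d), (if (a : ℕ) < 2 ^ s then (2 : ℝ) else 0) := by
        rw [Fin.sum_univ_eq_sum_range (fun a => if a < 2 ^ s then (2 : ℝ) else 0),
          ← Finset.sum_filter, hfilter]
    _ ≤ ∑ a : Fin (2 ^ d), if g a < geomSize d a then (2 : ℝ) else 0 := by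
        refine Finset.sum_le_sum fun a _ => ?_
        by_cases h : (a : ℕ) < 2 ^ s
        · rw [if_pos h, if_pos (hlt a ((hiff a).2 h))]
        · rw [if_neg h]
          split_ifs <;> norm_num

/-! ### Second moments on a product space -/

section Product

variable {ι α : Type*} [Fintype ι] [DecidableEq ι] [Fintype α]

/-- Averaging over one coordinate first. -/
lemma sum_sum_update (i : ι) (F : (ι → α) → ℝ) :
    ∑ x, ∑ a, F (Function.update x i a) = Fintype.card α * ∑ x, F x := by
  -- Exchanging the coordinate `x i` with `a` is an involution of the pairs `(x, a)`.
  have hinv : Function.Involutive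
      (fun z : (ι → α) × α => (Function.update z.1 i z.2, z.1 i)) := by
    rintro ⟨x, a⟩
    simp
  have h : ∑ z : (ι → α) × α, F (Function.update z.1 i z.2) = ∑ z : (ι → α) × α, F z.1 :=
    Equiv.sum_comp hinv.toPerm (fun z : (ι → α) × α => F z.1)
  rw [← Fintype.sum_prod_type' (f := fun x a => F (Function.update x i a)), h,
    Fintype.sum_prod_type]
  simp [Finset.mul_sum]

lemma sum_apply (i : ι) (f : α → ℝ) :
    (Fintype.card α : ℝ) * ∑ x : ι → α, f (x i) = Fintype.card (ι → α) * ∑ a, f a := by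
  rw [← sum_sum_update i fun x => f (x i)]
  simp

/-- The variance of a sum of independent, identically distributed variables. -/
lemma sum_sq_sum (f : α → ℝ) (hf : ∑ a, f a = 0) :
    ∑ x : ι → α, (∑ i, f (x i)) ^ 2 = ∑ i, ∑ x : ι → α, f (x i) ^ 2 := by
  rcases isEmpty_or_nonempty α with hα | hα
  · rcases isEmpty_or_nonempty ι with hι | hι
    · simp
    · simp
  have hα' : (Fintype.card α : ℝ) ≠ 0 := by exact_mod_cast Fintype.card_ne_zero
  have hcross : ∀ i j : ι, j ≠ i → ∑ x : ι → α, f (x i) * f (x j) = 0 := by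
    intro i j hij
    refine (mul_eq_zero.1 ?_).resolve_left hα'
    rw [← sum_sum_update i fun x => f (x i) * f (x j)]
    simp [Function.update_of_ne hij, ← Finset.sum_mul, hf]
  simp_rw [sq, Finset.sum_mul_sum]
  rw [Finset.sum_comm]
  refine Finset.sum_congr rfl fun i _ => ?_
  rw [Finset.sum_comm, Finset.sum_eq_single i (fun j _ hj => hcross i j hj) (by simp)]

/-- Chebyshev's inequality, in counting form, with the variance of each summand bounded by `b ^ 2`.
-/
lemma card_filter_mul_sq_le (f : α → ℝ) (hf : ∑ a, f a = 0) {b c : ℝ} (hb : ∀ a, |f a| ≤ b)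
    (hc : 0 ≤ c) :
    (((Finset.univ : Finset (ι → α)).filter fun x => c < ∑ i, f (x i)).card : ℝ) * c ^ 2 ≤
      Fintype.card ι * Fintype.card (ι → α) * b ^ 2 := by
  calc _ = ∑ x ∈ (Finset.univ : Finset (ι → α)).filter (fun x => c < ∑ i, f (x i)), c ^ 2 := by
        simp
    _ ≤ ∑ x ∈ (Finset.univ : Finset (ι → α)).filter (fun x => c < ∑ i, f (x i)),
          (∑ i, f (x i)) ^ 2 := Finset.sum_le_sum fun x hx =>
        pow_le_pow_left₀ hc (Finset.mem_filter.1 hx).2.le 2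
    _ ≤ ∑ x : ι → α, (∑ i, f (x i)) ^ 2 :=
        Finset.sum_le_sum_of_subset_of_nonneg (Finset.subset_univ _) fun _ _ _ => sq_nonneg _
    _ = ∑ i, ∑ x : ι → α, f (x i) ^ 2 := sum_sq_sum f hf
    _ ≤ ∑ _i : ι, ∑ _x : ι → α, b ^ 2 := Finset.sum_le_sum fun i _ =>
        Finset.sum_le_sum fun x _ => sq_le_sq.2 ((hb _).trans (le_abs_self b))
    _ = _ := by simp; ring

end Product

/-! ### The hard inputs and their offline cost -/

lemma geomSize_le (d a : ℕ) : geomSize d a ≤ d + 1 := by simp [geomSize]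

lemma one_le_geomSize (d a : ℕ) : 1 ≤ geomSize d a := by simp [geomSize]

/-- There are `n` jobs of estimate `1` and of sizes given by `x` at time `0`, followed by `L` unit
jobs that are released at the times `T`, `T + 1`, `T + 2` and so on. -/
noncomputable def streamInstance (L T : ℕ) {n d : ℕ} (x : Fin n → Fin (2 ^ d)) : Instance where
  n := n + L
  job := Fin.append
    (fun i => ⟨0, 1, geomSize d (x i), le_rfl, one_pos, by exact_mod_cast one_le_geomSize d _⟩)
    (fun l => ⟨((T + l : ℕ) : ℝ), 1, 1, Nat.cast_nonneg _, one_pos, one_pos⟩)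
  sorted := by
    intro i j hij
    induction i using Fin.addCases with
    | left i =>
      induction j using Fin.addCases with
      | left j => simp
      | right j =>
        simp only [Fin.append_left, Fin.append_right]
        positivity
    | right i =>
      induction j using Fin.addCases with
      | left j =>
        have := Fin.le_def.1 hij
        simp only [Fin.val_natAdd, Fin.val_castAdd] at this
        omega
      | right j =>
        have := Fin.le_def.1 hij
        simp only [Fin.val_natAdd] at this
        simp only [Fin.append_right]
        exact_mod_cast (by omega : T + (i : ℕ) ≤ T + j)

section Stream

variable {L T n d : ℕ} (x : Fin n → Fin (2 ^ d))

lemma streamInstance_job_left (i : Fin n) :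
    (streamInstance L T x).job (Fin.castAdd L i) =
      ⟨0, 1, geomSize d (x i), le_rfl, one_pos, by exact_mod_cast one_le_geomSize d _⟩ := by
  simp only [streamInstance, Fin.append_left]

lemma streamInstance_job_right (l : Fin L) :
    (streamInstance L T x).job (Fin.natAdd n l) =
      ⟨((T + l : ℕ) : ℝ), 1, 1, Nat.cast_nonneg _, one_pos, one_pos⟩ := by
  simp only [streamInstance, Fin.append_right]

/-- All sizes lie between the estimate 1 and `d + 1`, so only underestimation contributes. -/
lemma distortion_streamInstance_le : (streamInstance L T x).distortion ≤ d + 1 := by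
  have hd : (1 : ℝ) ≤ d + 1 := by linarith [Nat.cast_nonneg (α := ℝ) d]
  have h : ∀ i : Fin (n + L), ((streamInstance L T x).job i).est = 1 ∧
      1 ≤ ((streamInstance L T x).job i).proc ∧ ((streamInstance L T x).job i).proc ≤ d + 1 := by
    intro i
    induction i using Fin.addCases with
    | left i =>
      simp only [streamInstance_job_left, true_and]
      exact ⟨ by exact_mod_cast one_le_geomSize d _, by exact_mod_cast geomSize_le d _⟩
    | right i =>
      rw [streamInstance_job_right]
      exact ⟨rfl, le_rfl, hd⟩
  have h1 : (streamInstance L T x).underestimation ≤ d + 1 :=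
    max_le hd (Real.iSup_le (fun i => by rw [(h i).1, div_one]; exact (h i).2.2) (by linarith))
  have h2 : (streamInstance L T x).overestimation ≤ 1 :=
    max_le le_rfl (Real.iSup_le (fun i => by
      rw [(h i).1]
      exact div_le_one_of_le₀ (h i).2.1 (zero_le_one.trans (h i).2.1)) zero_le_one)
  calc (streamInstance L T x).distortion ≤ (d + 1) * 1 :=
        mul_le_mul h1 h2 (zero_le_one.trans (le_max_left _ _)) (by linarith)
    _ = d + 1 := mul_one _

/-- The schedule that completes the jobs of `F` before the stream of unit jobs, and the other large
jobs after it. -/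
lemma opt_streamInstance_le (F : Finset (Fin n)) (hF : ∑ i ∈ F, geomSize d (x i) ≤ T) :
    opt (streamInstance L T x) ≤
      ((n * T + Fᶜ.card * (T + L + n * (d + 1)) + L : ℕ) : ℝ≥0∞) := by
  obtain ⟨Q, hQ, hQd⟩ := exists_slots (fun i => geomSize d (x i)) 0 F
  obtain ⟨Q', hQ', hQd'⟩ := exists_slots (fun i => geomSize d (x i)) (T + L) Fᶜ
  have hsum : ∑ i ∈ Fᶜ, geomSize d (x i) ≤ n * (d + 1) := by
    calc ∑ i ∈ Fᶜ, geomSize d (x i) ≤ ∑ i, geomSize d (x i) :=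
          Finset.sum_le_sum_of_subset (Finset.subset_univ _)
      _ ≤ ∑ _i : Fin n, (d + 1) := Finset.sum_le_sum fun i _ => geomSize_le d _
      _ = n * (d + 1) := by simp
  have hQT : ∀ i ∈ F, ∀ s ∈ Q i, s < T := fun i hi s hs => by
    have := Finset.mem_Ico.1 ((hQ i hi).2 hs)
    omega
  have hQT' : ∀ i ∉ F, ∀ s ∈ Q' i, T + L ≤ s ∧ s < T + L + n * (d + 1) := fun i hi s hs => by
    have := Finset.mem_Ico.1 ((hQ' i (Finset.mem_compl.2 hi)).2 hs)
    omega
  let R : Fin n → Finset ℕ := fun i => if i ∈ F then Q i else Q' i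
  have hR : ∀ i, i ∈ F → R i = Q i := fun i hi => if_pos hi
  have hR' : ∀ i, i ∉ F → R i = Q' i := fun i hi => if_neg hi
  have hRs : ∀ i (l : Fin L), T + (l : ℕ) ∉ R i := by
    intro i l hl
    by_cases hi : i ∈ F
    · have := hQT i hi _ (hR i hi ▸ hl)
      omega
    · have := hQT' i hi _ (hR' i hi ▸ hl)
      omega
  have hRd : ∀ i j, i ≠ j → Disjoint (R i) (R j) := by
    intro i j hij
    by_cases hi : i ∈ F <;> by_cases hj : j ∈ F
    · rw [hR i hi, hR j hj]
      exact hQd hi hj hij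
    · rw [hR i hi, hR' j hj, Finset.disjoint_left]
      intro s hs hs'
      have := hQT i hi s hs
      have := hQT' j hj s hs'
      omega
    · rw [hR' i hi, hR j hj, Finset.disjoint_left]
      intro s hs hs'
      have := hQT' i hi s hs
      have := hQT j hj s hs'
      omega
    · rw [hR' i hi, hR' j hj]
      exact hQd' (by simpa using hi) (by simpa using hj) hij
  -- The deadlines are crude: `T` for every job of `F`, the end of the whole schedule for the other
  -- large jobs. Only the coefficient of `L` matters in the end.
  refine (opt_le_sum (I := streamInstance L T x)
    (Fin.append (fun i => geomSize d (x i)) (fun _ : Fin L => 1))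
    (Fin.append (fun _ => 0) (fun l : Fin L => T + l))
    (Fin.append (fun i => if i ∈ F then T else T + L + n * (d + 1)) (fun l : Fin L => T + l + 1))
    ?_ ?_ (Fin.append R (fun l : Fin L => {T + (l : ℕ)})) ?_ ?_ ?_ ?_).trans ?_
  · intro i
    induction i using Fin.addCases with
    | left i => rw [streamInstance_job_left, Fin.append_left]
    | right i => rw [streamInstance_job_right, Fin.append_right, Nat.cast_one]
  · intro i
    induction i using Fin.addCases with
    | left i => simp only [streamInstance_job_left, Fin.append_left, Nat.cast_zero]
    | right i => rw [streamInstance_job_right, Fin.append_right]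
  · intro i j hij
    induction i using Fin.addCases with
    | left i =>
      induction j using Fin.addCases with
      | left j =>
        simp only [Fin.append_left]
        exact hRd i j fun h => hij (h ▸ rfl)
      | right j =>
        simp only [Fin.append_left, Fin.append_right, Finset.disjoint_singleton_right]
        exact hRs i j
    | right i =>
      induction j using Fin.addCases with
      | left j =>
        simp only [Fin.append_left, Fin.append_right, Finset.disjoint_singleton_left]
        exact hRs j i
      | right j =>
        simp only [Fin.append_right, Finset.disjoint_singleton]
        intro h
        exact hij (congrArg (Fin.natAdd n) (Fin.ext (by omega)))
  · intro i
    induction i using Fin.addCases with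
    | left i =>
      simp only [Fin.append_left]
      by_cases hi : i ∈ F
      · rw [hR i hi, (hQ i hi).1]
      · rw [hR' i hi, (hQ' i (Finset.mem_compl.2 hi)).1]
    | right i => simp only [Fin.append_right, Finset.card_singleton, le_rfl]
  · intro i
    induction i using Fin.addCases with
    | left i => simp only [Fin.append_left, Nat.zero_le, implies_true]
    | right i => simp only [Fin.append_right, Finset.mem_singleton, forall_eq, le_rfl]
  · intro i
    induction i using Fin.addCases with
    | left i =>
      simp only [Fin.append_left]
      by_cases hi : i ∈ F
      · simpa only [hR i hi, if_pos hi] using hQT i hi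
      · simpa only [hR' i hi, if_neg hi] using fun s hs => (hQT' i hi s hs).2
    | right i => simp only [Fin.append_right, Finset.mem_singleton, forall_eq, Nat.lt_succ_self]
  · refine Nat.cast_le.2 ?_
    have h1 : ∑ l : Fin L, (T + (l : ℕ) + 1 - (T + l)) = L := by
      simp
    have h2 : ∑ i : Fin n, (if i ∈ F then T else T + L + n * (d + 1)) ≤
        n * T + Fᶜ.card * (T + L + n * (d + 1)) := by
      calc _ ≤ ∑ i : Fin n, (T + if i ∈ Fᶜ then T + L + n * (d + 1) else 0) := by
            refine Finset.sum_le_sum fun i _ => ?_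
            by_cases hi : i ∈ F <;> simp [hi]
        _ = _ := by
            rw [Finset.sum_add_distrib, Finset.sum_ite_mem, Finset.univ_inter]
            simp
    change ∑ i : Fin (n + L), _ ≤ _
    rw [Fin.sum_univ_add]
    simp only [Fin.append_left, Fin.append_right, h1, Nat.sub_zero]
    omega

end Stream

/-! ### The online cost during the stream -/

section Alive

open Classical in
/-- `1` if the job `i` is released before time `l` and not completed at that time, else `0`. -/
noncomputable def alive {I : Instance} (S : Schedule I) (i : Fin I.n) (l : ℕ) : ℝ :=
  if (I.job i).release < l ∧ ¬ S.Completed i l then 1 else 0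

lemma alive_nonneg {I : Instance} (S : Schedule I) (i : Fin I.n) (l : ℕ) : 0 ≤ alive S i l := by
  unfold alive
  split_ifs <;> norm_num

/-- Flow time is the integral of the number of released unfinished jobs. With integral release
times, sampling it at integers bounds it from below. -/
lemma sum_alive_le_flowTime {I : Instance} (S : Schedule I) (r : Fin I.n → ℕ)
    (hr : ∀ i, (I.job i).release = r i) (F : Finset ℕ) :
    ENNReal.ofReal (∑ i, ∑ l ∈ F, alive S i l) ≤ S.flowTime := by
  classical
  rw [ENNReal.ofReal_sum_of_nonneg fun i _ => Finset.sum_nonneg fun l _ => alive_nonneg S i l]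
  refine Finset.sum_le_sum fun i _ => ?_
  refine le_trans (le_of_eq ?_) (S.card_le_flow (hr i)
    (F.filter fun l : ℕ => (I.job i).release < l ∧ ¬ S.Completed i l) fun l hl => ?_)
  · unfold alive
    rw [← Finset.sum_filter, Finset.sum_const, nsmul_one, ENNReal.ofReal_natCast]
  · have := (Finset.mem_filter.1 hl).2
    rw [hr i] at this
    exact ⟨by exact_mod_cast this.1, this.2⟩

/-- Conservation of volume: by time `l` the released volume is the large jobs' total plus `l - T`,
and at most `l` has been processed. An unfinished stream job accounts for at most 1 of the
remainder. -/
lemma sub_le_sum_alive {L T n d : ℕ} (x : Fin n → Fin (2 ^ d)) (S : Schedule (streamInstance L T x))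
    {l : ℕ} (hTl : T < l) (hl : l ≤ T + L) :
    ∑ i, (geomSize d (x i) : ℝ) - T ≤
      ∑ i, max 0 ((geomSize d (x i) : ℝ) - S.work (Fin.castAdd L i) l) +
        ∑ k : Fin L, alive S (Fin.natAdd n k) l := by
  classical
  have hwork : ∑ i : Fin n, S.work (Fin.castAdd L i) l +
      ∑ k : Fin L, S.work (Fin.natAdd n k) l ≤ l := by
    have h := S.sum_work_le (Nat.cast_nonneg l)
    change ∑ i : Fin (n + L), S.work i l ≤ l at h
    rwa [Fin.sum_univ_add] at h
  have h1 : ∑ i, (geomSize d (x i) : ℝ) - ∑ i : Fin n, S.work (Fin.castAdd L i) l ≤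
      ∑ i, max 0 ((geomSize d (x i) : ℝ) - S.work (Fin.castAdd L i) l) := by
    rw [← Finset.sum_sub_distrib]
    exact Finset.sum_le_sum fun i _ => le_max_right _ _
  have h2 : ∑ k : Fin L, (if (k : ℕ) < l - T then (1 : ℝ) else 0) -
      ∑ k : Fin L, S.work (Fin.natAdd n k) l ≤ ∑ k : Fin L, alive S (Fin.natAdd n k) l := by
    rw [← Finset.sum_sub_distrib]
    refine Finset.sum_le_sum fun k _ => ?_
    have hw := S.work_nonneg (Fin.natAdd n k) (Nat.cast_nonneg (α := ℝ) l)
    split_ifs with hk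
    · unfold alive
      split_ifs with hal
      · linarith
      · simp only [streamInstance_job_right, not_and, not_not] at hal
        have hc := hal (by exact_mod_cast (by omega : T + (k : ℕ) < l))
        simp only [Schedule.Completed, streamInstance_job_right] at hc
        linarith
    · have := alive_nonneg S (Fin.natAdd n k) l
      linarith
  have h3 : ∑ k : Fin L, (if (k : ℕ) < l - T then (1 : ℝ) else 0) = l - T := by
    have hf : (Finset.range L).filter (fun k => k < l - T) = Finset.range (l - T) := by
      ext k
      simp only [Finset.mem_filter, Finset.mem_range]
      omega
    rw [Fin.sum_univ_eq_sum_range (fun k => if k < l - T then (1 : ℝ) else 0) L,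
      ← Finset.sum_filter, hf]
    simp [Nat.cast_sub hTl.le]
  linarith

/-- The memoryless property, for the jobs released at time `0`. -/
lemma sum_max_le_sum_alive (A : OnlineAlgorithm) {L T n d : ℕ} (i : Fin n) {l : ℕ} (hl : 0 < l) :
    ∑ x : Fin n → Fin (2 ^ d), max 0 ((geomSize d (x i) : ℝ) -
        (A.schedule (streamInstance L T x)).work (Fin.castAdd L i) l) ≤
      ∑ x : Fin n → Fin (2 ^ d),
        2 * alive (A.schedule (streamInstance L T x)) (Fin.castAdd L i) l := by
  have hN : (0 : ℝ) < Fintype.card (Fin (2 ^ d)) := by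
    rw [Fintype.card_fin]; positivity
  refine le_of_mul_le_mul_left ?_ hN
  -- Only the size of job `i` is resampled, the other sizes being fixed.
  rw [← sum_sum_update i fun x : Fin n → Fin (2 ^ d) => max 0 ((geomSize d (x i) : ℝ) -
    (A.schedule (streamInstance L T x)).work (Fin.castAdd L i) l), ← sum_sum_update i
    fun x : Fin n → Fin (2 ^ d) =>
      2 * alive (A.schedule (streamInstance L T x)) (Fin.castAdd L i) l]
  refine Finset.sum_le_sum fun x _ => ?_
  simp only [Function.update_self]
  refine (sum_remaining_le d (fun a => (A.schedule (streamInstance L T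
    (Function.update x i a))).work (Fin.castAdd L i) l)
    (fun a => Schedule.work_nonneg _ _ (Nat.cast_nonneg l)) ?_).trans (le_of_eq ?_)
  · intro j a a' hj ha ha'
    -- As long as job `i` has received less than `j`, the algorithm cannot tell apart two sizes that
    -- are at least `j`.
    refine lt_of_eq_of_lt (A.work_eq_work (N := n + L) (c := j)
      (streamInstance L T (Function.update x i a)).sorted
      (streamInstance L T (Function.update x i a')).sorted (Fin.castAdd L i) ?_ ?_ ?_
      (Nat.cast_nonneg l) ?_ ?_ hj) hj
    · intro k
      induction k using Fin.addCases with
      | left k => rw [streamInstance_job_left, streamInstance_job_left]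
      | right k => rw [streamInstance_job_right, streamInstance_job_right]
    · intro k
      induction k using Fin.addCases with
      | left k => rw [streamInstance_job_left, streamInstance_job_left]
      | right k => rw [streamInstance_job_right, streamInstance_job_right]
    · intro k hk
      induction k using Fin.addCases with
      | left k =>
        have hki : k ≠ i := fun h => hk (h ▸ rfl)
        simp only [streamInstance_job_left, Function.update_of_ne hki]
      | right k => rw [streamInstance_job_right, streamInstance_job_right]
    · simp only [streamInstance_job_left, Function.update_self]
      exact_mod_cast ha
    · simp only [streamInstance_job_left, Function.update_self]
      exact_mod_cast ha'
  · refine Finset.sum_congr rfl fun a _ => ?_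
    have hl' : (0 : ℝ) < l := by exact_mod_cast hl
    unfold alive
    simp only [Schedule.Completed, streamInstance_job_left, Function.update_self, not_le, hl',
      true_and]
    split_ifs <;> norm_num

/-- The number of unfinished jobs, averaged over the sizes, stays large during the stream. -/
lemma sum_cost_ge (A : OnlineAlgorithm) (L T n d : ℕ) :
    ENNReal.ofReal (L * (∑ x : Fin n → Fin (2 ^ d), ∑ i, (geomSize d (x i) : ℝ) -
        Fintype.card (Fin n → Fin (2 ^ d)) * T) / 2) ≤
      ∑ x : Fin n → Fin (2 ^ d), A.cost (streamInstance L T x) := by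
  obtain ⟨g, hg⟩ : ∃ g : (Fin n → Fin (2 ^ d)) → ℕ → ℝ, ∀ x l, g x l =
      ∑ i : Fin (n + L), alive (A.schedule (streamInstance L T x)) i l := ⟨_, fun _ _ => rfl⟩
  have hg0 : ∀ x l, 0 ≤ g x l := fun x l => by
    rw [hg]
    exact Finset.sum_nonneg fun i _ =>
      alive_nonneg (A.schedule (streamInstance L T x)) i l
  have hcost : ∀ x : Fin n → Fin (2 ^ d), ENNReal.ofReal (∑ l ∈ Finset.Ioc T (T + L), g x l) ≤
      A.cost (streamInstance L T x) := by
    intro x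
    simp only [hg]
    rw [Finset.sum_comm]
    refine sum_alive_le_flowTime (A.schedule (streamInstance L T x))
      (Fin.append (fun _ => 0) (fun l : Fin L => T + l)) (fun i => ?_) (Finset.Ioc T (T + L))
    induction i using Fin.addCases with
    | left i => simp only [streamInstance_job_left, Fin.append_left, Nat.cast_zero]
    | right i => rw [streamInstance_job_right, Fin.append_right]
  refine le_trans ?_ (Finset.sum_le_sum fun x _ => hcost x)
  rw [← ENNReal.ofReal_sum_of_nonneg fun x _ => Finset.sum_nonneg fun l _ => hg0 x l]
  refine ENNReal.ofReal_le_ofReal ?_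
  have hl : ∀ l ∈ Finset.Ioc T (T + L), (∑ x : Fin n → Fin (2 ^ d), ∑ i, (geomSize d (x i) : ℝ) -
      Fintype.card (Fin n → Fin (2 ^ d)) * T) / 2 ≤ ∑ x : Fin n → Fin (2 ^ d),
        g x l := by
    intro l hl
    rw [Finset.mem_Ioc] at hl
    have h1 := Finset.sum_le_sum fun (x : Fin n → Fin (2 ^ d)) (_ : x ∈ Finset.univ) =>
      sub_le_sum_alive x (A.schedule (streamInstance L T x)) hl.1 hl.2
    have h2 := Finset.sum_le_sum fun (i : Fin n) (_ : i ∈ Finset.univ) =>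
      sum_max_le_sum_alive A (L := L) (T := T) (d := d) i (l := l) (by omega)
    rw [Finset.sum_sub_distrib, Finset.sum_add_distrib, Finset.sum_const, Finset.card_univ,
      nsmul_eq_mul] at h1
    rw [Finset.sum_comm, Finset.sum_comm (s := Finset.univ (α := Fin n))] at h2
    -- Stream jobs count once in `h1`, large jobs twice in `h2`; nonnegativity allows the factor 2
    -- on all of them.
    have h3 : (0 : ℝ) ≤ ∑ x : Fin n → Fin (2 ^ d), ∑ k : Fin L,
        alive (A.schedule (streamInstance L T x)) (Fin.natAdd n k) l :=
      Finset.sum_nonneg fun x _ => Finset.sum_nonneg fun k _ => alive_nonneg _ _ l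
    simp_rw [hg, Fin.sum_univ_add, Finset.sum_add_distrib]
    simp_rw [← Finset.mul_sum] at h2
    linarith
  have := Finset.card_nsmul_le_sum _ _ _ hl
  rw [Nat.card_Ioc, nsmul_eq_mul, Nat.add_sub_cancel_left,
    Finset.sum_comm (s := Finset.Ioc T (T + L))] at this
  linarith

end Alive

/-! ### Average number of jobs postponed offline -/

lemma sum_geomSize_fin (d : ℕ) : ∑ a : Fin (2 ^ d), (geomSize d a : ℝ) = 2 ^ (d + 1) - 1 := by
  rw [Fin.sum_univ_eq_sum_range (fun a => (geomSize d a : ℝ)), ← Nat.cast_sum, sum_geomSize,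
    Nat.cast_sub Nat.one_le_two_pow]
  simp

/-- The beginning of the stream: the expected total size of the large jobs, less `K * (d + 1)`. -/
def streamStart (d K : ℕ) : ℕ := K * (2 * (2 ^ (d + 1) - 1) - (d + 1))

lemma streamStart_cast (d K : ℕ) :
    (streamStart d K : ℝ) = K * (2 * (2 ^ (d + 1) - 1) - (d + 1)) := by
  have h : d + 1 < 2 ^ (d + 1) := Nat.lt_two_pow_self
  have h1 : 1 ≤ 2 ^ (d + 1) := Nat.one_le_two_pow
  rw [streamStart, Nat.cast_mul, Nat.cast_sub (by omega), Nat.cast_mul, Nat.cast_sub h1]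
  simp

lemma sum_ite_val_eq_zero (d : ℕ) (c : ℝ) :
    ∑ a : Fin (2 ^ d), (if (a : ℕ) = 0 then c else 0) = c := by
  rw [Fin.sum_univ_eq_sum_range (fun a => if a = 0 then c else 0)]
  simp

lemma sum_sum_geomSize (d K : ℕ) :
    ∑ x : Fin (K * 2 ^ (d + 1)) → Fin (2 ^ d), ∑ i, (geomSize d (x i) : ℝ) =
      Fintype.card (Fin (K * 2 ^ (d + 1)) → Fin (2 ^ d)) * (2 * K * (2 ^ (d + 1) - 1)) := by
  have hd : (0 : ℝ) < 2 ^ d := by positivity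
  refine mul_left_cancel₀ hd.ne' ?_
  rw [Finset.sum_comm, Finset.mul_sum]
  have h : ∀ i : Fin (K * 2 ^ (d + 1)), (2 : ℝ) ^ d *
      ∑ x : Fin (K * 2 ^ (d + 1)) → Fin (2 ^ d), (geomSize d (x i) : ℝ) =
      Fintype.card (Fin (K * 2 ^ (d + 1)) → Fin (2 ^ d)) * (2 ^ (d + 1) - 1) := by
    intro i
    have := sum_apply i fun a : Fin (2 ^ d) => (geomSize d a : ℝ)
    rwa [sum_geomSize_fin, Fintype.card_fin, Nat.cast_pow, Nat.cast_ofNat] at this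
  rw [Finset.sum_congr rfl fun i _ => h i, Finset.sum_const, Finset.card_univ, Fintype.card_fin,
    nsmul_eq_mul]
  push_cast
  ring

open Classical in
/-- The jobs which the offline schedule completes before the stream: all those that do not have the
maximal size, provided that they fit in. -/
noncomputable def earlyJobs (T : ℕ) {n d : ℕ} (x : Fin n → Fin (2 ^ d)) : Finset (Fin n) :=
  if ∑ i with (x i : ℕ) ≠ 0, geomSize d (x i) ≤ T then Finset.univ.filter fun i => (x i : ℕ) ≠ 0
  else ∅

lemma sum_earlyJobs_le (T : ℕ) {n d : ℕ} (x : Fin n → Fin (2 ^ d)) :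
    ∑ i ∈ earlyJobs T x, geomSize d (x i) ≤ T := by
  unfold earlyJobs
  split_ifs with h
  · exact h
  · simp

/-- The maximal size is attained at `a = 0`. If the other jobs fit in, exactly those with `x i = 0`
are postponed; if not, all `n` are. -/
lemma card_compl_earlyJobs_le (T : ℕ) {n d : ℕ} (x : Fin n → Fin (2 ^ d)) :
    (((earlyJobs T x)ᶜ.card : ℕ) : ℝ) ≤ ∑ i, (if (x i : ℕ) = 0 then (1 : ℝ) else 0) +
      n * (if T < ∑ i, (if (x i : ℕ) = 0 then 0 else geomSize d (x i)) then (1 : ℝ) else 0) := by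
  have hsum : ∑ i with (x i : ℕ) ≠ 0, geomSize d (x i) =
      ∑ i, (if (x i : ℕ) = 0 then 0 else geomSize d (x i)) := by
    rw [Finset.sum_filter]
    exact Finset.sum_congr rfl fun i _ => ite_not _ _ _
  unfold earlyJobs
  rw [hsum]
  by_cases h : ∑ i, (if (x i : ℕ) = 0 then 0 else geomSize d (x i)) ≤ T
  · rw [if_pos h, if_neg (not_lt.2 h), ← Finset.sum_filter]
    rw [Finset.compl_filter]
    simp
  · rw [if_neg h, if_pos (not_le.1 h)]
    simp

/-- The expected volume of the jobs of nonmaximal size is `streamStart d K - K * (d + 1)`, so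
overflow is a deviation above `K * (d + 1)`. Chebyshev bounds its probability by `n / K ^ 2`, and
`n` times this is `4 ^ (d + 1)`. -/
lemma card_overfull_le (d K : ℕ) (hK : 0 < K) :
    (K * 2 ^ (d + 1) : ℝ) * ((Finset.univ.filter fun x : Fin (K * 2 ^ (d + 1)) → Fin (2 ^ d) =>
        streamStart d K < ∑ i, (if (x i : ℕ) = 0 then 0 else geomSize d (x i))).card : ℝ) ≤
      Fintype.card (Fin (K * 2 ^ (d + 1)) → Fin (2 ^ d)) * 4 ^ (d + 1) := by
  let v : Fin (2 ^ d) → ℝ := fun a => if (a : ℕ) = 0 then 0 else geomSize d a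
  have hd : (0 : ℝ) < 2 ^ d := by positivity
  have hv0 : ∀ a, 0 ≤ v a := fun a => by
    simp only [v]
    split_ifs <;> positivity
  have hv1 : ∀ a, v a ≤ d + 1 := fun a => by
    simp only [v]
    split_ifs
    · positivity
    · exact_mod_cast geomSize_le d a
  have hvsum : ∑ a, v a = 2 ^ (d + 1) - 1 - (d + 1) := by
    rw [← sum_geomSize_fin, ← sum_ite_val_eq_zero d (d + 1 : ℝ)]
    rw [← Finset.sum_sub_distrib]
    refine Finset.sum_congr rfl fun a _ => ?_
    simp only [v]
    split_ifs with h
    · simp [h, geomSize]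
    · simp
  set mean : ℝ := (∑ a, v a) / 2 ^ d with hmean
  have hmean0 : 0 ≤ mean := div_nonneg (Finset.sum_nonneg fun a _ => hv0 a) hd.le
  have hmean1 : mean ≤ d + 1 := by
    rw [hmean, div_le_iff₀ hd]
    have := Finset.sum_le_card_nsmul Finset.univ v (d + 1 : ℝ) fun a _ => hv1 a
    simp only [Finset.card_univ, Fintype.card_fin, nsmul_eq_mul, Nat.cast_pow,
      Nat.cast_ofNat] at this
    linarith
  have hcheb := card_filter_mul_sq_le (ι := Fin (K * 2 ^ (d + 1))) (fun a => v a - mean)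
    (by
      rw [Finset.sum_sub_distrib, Finset.sum_const, Finset.card_univ, Fintype.card_fin,
        nsmul_eq_mul, hmean]
      push_cast
      field_simp
      ring)
    (b := d + 1) (c := K * (d + 1))
    (fun a => abs_le.2 ⟨by linarith [hv0 a], by linarith [hv1 a]⟩) (by positivity)
  have hiff : ∀ x : Fin (K * 2 ^ (d + 1)) → Fin (2 ^ d),
      streamStart d K < ∑ i, (if (x i : ℕ) = 0 then 0 else geomSize d (x i)) ↔
      (K * (d + 1) : ℝ) < ∑ i, (v (x i) - mean) := by
    intro x
    have h1 : ((∑ i, (if (x i : ℕ) = 0 then 0 else geomSize d (x i)) : ℕ) : ℝ) =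
        ∑ i, v (x i) := by
      push_cast
      rfl
    have h2 : ((K * 2 ^ (d + 1) : ℕ) : ℝ) * mean = 2 * K * (2 ^ (d + 1) - 1 - (d + 1)) := by
      rw [hmean, hvsum]
      push_cast
      field_simp
      ring
    rw [← Nat.cast_lt (α := ℝ), h1, streamStart_cast, Finset.sum_sub_distrib, Finset.sum_const,
      Finset.card_univ, Fintype.card_fin, nsmul_eq_mul, h2]
    constructor <;> intro h <;> linarith
  simp only [hiff]
  set c : ℝ := ((Finset.univ.filter fun x : Fin (K * 2 ^ (d + 1)) → Fin (2 ^ d) =>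
    (K * (d + 1) : ℝ) < ∑ i, (v (x i) - mean)).card : ℝ)
  have hpos : (0 : ℝ) < K * (d + 1) ^ 2 := by positivity
  rw [Fintype.card_fin] at hcheb
  have h4 : (4 : ℝ) ^ (d + 1) = 2 ^ (d + 1) * 2 ^ (d + 1) := by
    rw [← mul_pow]; norm_num
  refine le_of_mul_le_mul_left ?_ hpos
  have h := mul_le_mul_of_nonneg_left hcheb (by positivity : (0 : ℝ) ≤ 2 ^ (d + 1))
  push_cast at h
  rw [h4]
  linarith

lemma sum_card_compl_earlyJobs_le (d K : ℕ) (hK : 0 < K) :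
    ∑ x : Fin (K * 2 ^ (d + 1)) → Fin (2 ^ d), (((earlyJobs (streamStart d K) x)ᶜ.card : ℕ) : ℝ) ≤
      Fintype.card (Fin (K * 2 ^ (d + 1)) → Fin (2 ^ d)) * (2 * K + 4 ^ (d + 1)) := by
  have hd : (0 : ℝ) < 2 ^ d := by positivity
  have hzero : ∑ x : Fin (K * 2 ^ (d + 1)) → Fin (2 ^ d), ∑ i,
      (if (x i : ℕ) = 0 then (1 : ℝ) else 0) =
      Fintype.card (Fin (K * 2 ^ (d + 1)) → Fin (2 ^ d)) * (2 * K) := by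
    refine mul_left_cancel₀ hd.ne' ?_
    rw [Finset.sum_comm, Finset.mul_sum]
    have h : ∀ i : Fin (K * 2 ^ (d + 1)), (2 : ℝ) ^ d *
        ∑ x : Fin (K * 2 ^ (d + 1)) → Fin (2 ^ d), (if (x i : ℕ) = 0 then (1 : ℝ) else 0) =
        Fintype.card (Fin (K * 2 ^ (d + 1)) → Fin (2 ^ d)) := by
      intro i
      have := sum_apply i fun a : Fin (2 ^ d) => if (a : ℕ) = 0 then (1 : ℝ) else 0
      rwa [sum_ite_val_eq_zero, mul_one, Fintype.card_fin, Nat.cast_pow, Nat.cast_ofNat] at this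
    rw [Finset.sum_congr rfl fun i _ => h i, Finset.sum_const, Finset.card_univ, Fintype.card_fin,
      nsmul_eq_mul]
    push_cast
    ring
  refine (Finset.sum_le_sum fun x _ => card_compl_earlyJobs_le _ x).trans ?_
  rw [Finset.sum_add_distrib, hzero, ← Finset.mul_sum, Finset.sum_boole, mul_add]
  have := card_overfull_le d K hK
  push_cast
  linarith

/-! ### Comparison of the two costs -/

lemma le_of_forall_nat_mul_le {a b c : ℝ} (h : ∀ L : ℕ, L * a ≤ c + L * b) : a ≤ b := by
  by_contra! hlt
  obtain ⟨L, hL⟩ := exists_nat_gt (c / (a - b))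
  rw [div_lt_iff₀ (by linarith)] at hL
  linarith [h L]

/-- The lower bound, for distortion `d + 1`. -/
theorem le_competitive_ratio {Ω : Type*} [MeasurableSpace Ω] (P : Measure Ω)
    [IsProbabilityMeasure P] (A : RandomizedAlgorithm P) (μ : ℝ) (ρ : ℝ≥0)
    (h : A.IsCompetitive μ ρ) (d : ℕ) (hd : d + 1 ≤ μ) : (d + 1 : ℝ) ≤ 8 * ρ := by
  obtain ⟨b, hb⟩ := h
  -- This choice bounds the expected number of jobs postponed because of overflow by `K`.
  set K : ℕ := 4 ^ (d + 1) with hKdef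
  have hK : 0 < K := by positivity
  set n := K * 2 ^ (d + 1) with hn
  set T := streamStart d K with hT
  set W : ℝ := (Fintype.card (Fin n → Fin (2 ^ d)) : ℝ) with hW
  have : Nonempty (Fin (2 ^ d)) := ⟨⟨0, by positivity⟩⟩
  have hW0 : 0 < W := by
    rw [hW]; exact_mod_cast Fintype.card_pos
  -- Both costs, averaged over the sizes, are bounded by affine functions of `L`; only their slopes
  -- survive as `L` grows, which also disposes of the additive constant `b`.
  have hmain : ∀ L : ℕ, L * ((K : ℝ) * (d + 1) / 2) ≤
      ρ * (n * T + (2 * K + 4 ^ (d + 1)) * (T + n * (d + 1))) + b +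
        L * (ρ * (2 * K + 4 ^ (d + 1) + 1)) := by
    intro L
    let B : (Fin n → Fin (2 ^ d)) → ℕ := fun x =>
      n * T + (earlyJobs T x)ᶜ.card * (T + L + n * (d + 1)) + L
    have hupper : ∀ x : Fin n → Fin (2 ^ d), A.cost (streamInstance L T x) ≤
        ENNReal.ofReal (ρ * B x + b) := by
      intro x
      refine (hb _ ((distortion_streamInstance_le x).trans hd)).trans ?_
      rw [ENNReal.ofReal_add (p := ρ * B x) (by positivity) b.coe_nonneg, ENNReal.ofReal_mul ρ.coe_nonneg, ENNReal.ofReal_natCast,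
        ENNReal.ofReal_coe_nnreal, ENNReal.ofReal_coe_nnreal]
      gcongr
      exact opt_streamInstance_le x _ (sum_earlyJobs_le T x)
    have hlower : ENNReal.ofReal (L * (∑ x : Fin n → Fin (2 ^ d), ∑ i, (geomSize d (x i) : ℝ) -
        W * T) / 2) ≤ ∑ x : Fin n → Fin (2 ^ d), A.cost (streamInstance L T x) := by
      simp only [RandomizedAlgorithm.cost]
      -- The averaged bound holds for each deterministic algorithm `A.alg ω`, hence for its
      -- expectation.
      rw [← lintegral_finsetSum' _ fun x _ => A.aemeasurable_cost _]
      calc _ = ∫⁻ _ω, ENNReal.ofReal (L * (∑ x : Fin n → Fin (2 ^ d),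
            ∑ i, (geomSize d (x i) : ℝ) - W * T) / 2) ∂P := by simp
        _ ≤ _ := lintegral_mono fun ω => sum_cost_ge (A.alg ω) L T n d
    have hle := hlower.trans (Finset.sum_le_sum fun x _ => hupper x)
    rw [← ENNReal.ofReal_sum_of_nonneg fun x _ => by positivity,
      ENNReal.ofReal_le_ofReal_iff (Finset.sum_nonneg fun x _ => by positivity),
      sum_sum_geomSize, ← hW, hT, streamStart_cast, Finset.sum_add_distrib,
      ← Finset.mul_sum, Finset.sum_const, Finset.card_univ, nsmul_eq_mul, ← hW] at hle
    have hB : ∑ x : Fin n → Fin (2 ^ d), (B x : ℝ) ≤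
        W * (n * T + (2 * K + 4 ^ (d + 1)) * (T + L + n * (d + 1)) + L) := by
      have hE := sum_card_compl_earlyJobs_le d K hK
      rw [← hW] at hE
      simp only [B, Nat.cast_add, Nat.cast_mul, Nat.cast_one]
      rw [Finset.sum_add_distrib, Finset.sum_add_distrib, Finset.sum_const,
        Finset.sum_const, ← Finset.sum_mul, Finset.card_univ, nsmul_eq_mul, nsmul_eq_mul, ← hW]
      have := mul_le_mul_of_nonneg_right hE
        (by positivity : (0 : ℝ) ≤ (T : ℝ) + L + n * (d + 1))
      linarith
    have hρ := mul_le_mul_of_nonneg_left hB ρ.coe_nonneg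
    refine le_of_mul_le_mul_left ?_ hW0
    linarith
  have hlim := le_of_forall_nat_mul_le hmain
  have hK1 : (1 : ℝ) ≤ K := by exact_mod_cast hK
  have hK4 : (4 : ℝ) ^ (d + 1) = K := by rw [hKdef]; push_cast; rfl
  rw [hK4] at hlim
  have h4 : (ρ : ℝ) * (2 * K + K + 1) ≤ ρ * (4 * K) :=
    mul_le_mul_of_nonneg_left (by linarith) ρ.coe_nonneg
  refine le_of_mul_le_mul_left ?_ (by linarith : (0 : ℝ) < K)
  linarith

/-- A deterministic algorithm, as a randomized one. -/
noncomputable def OnlineAlgorithm.toRandomized (A : OnlineAlgorithm) :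
    RandomizedAlgorithm (Measure.dirac () : Measure Unit) where
  alg _ := A
  aemeasurable_cost _ := aemeasurable_const

lemma OnlineAlgorithm.IsCompetitive.toRandomized {A : OnlineAlgorithm} {μ : ℝ} {ρ : ℝ≥0}
    (h : A.IsCompetitive μ ρ) : A.toRandomized.IsCompetitive μ ρ := by
  obtain ⟨b, hb⟩ := h
  refine ⟨b, fun I hI => ?_⟩
  have hcost : A.toRandomized.cost I = A.cost I := by
    unfold RandomizedAlgorithm.cost
    rw [lintegral_dirac]
    rfl
  rw [hcost]
  exact hb I hI

end FlowTime

/-- One absolute constant `c > 0` serves all distortion parameters `μ` and all algorithms (which may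
know `μ`): no competitive ratio below `c * μ` is possible on inputs of distortion at most `μ`. -/
theorem mainTheorem2 :
    ∃ c : ℝ, 0 < c ∧ ∀ μ : ℝ, 1 ≤ μ →
      (∀ (Ω : Type*) [MeasurableSpace Ω] (P : Measure Ω) [IsProbabilityMeasure P]
        (A : FlowTime.RandomizedAlgorithm P) (ρ : ℝ≥0), A.IsCompetitive μ ρ → c * μ ≤ ρ) ∧
      (∀ (A : FlowTime.OnlineAlgorithm) (ρ : ℝ≥0), A.IsCompetitive μ ρ → c * μ ≤ ρ) := by
  -- With `d + 1 = ⌊μ⌋₊`, one has `μ < d + 2 ≤ 2 * (d + 1)`, so the factor 8 becomes 16.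
  refine ⟨1 / 16, by norm_num, fun μ hμ => ?_⟩
  obtain ⟨d, hd⟩ : ∃ d, ⌊μ⌋₊ = d + 1 :=
    Nat.exists_eq_succ_of_ne_zero (Nat.floor_pos.2 hμ).ne'
  have hdμ : (d : ℝ) + 1 ≤ μ := by
    have := Nat.floor_le (zero_le_one.trans hμ)
    rw [hd] at this
    exact_mod_cast this
  have hμd : μ < d + 1 + 1 := by
    have := Nat.lt_floor_add_one μ
    rw [hd] at this
    exact_mod_cast this
  have hd0 : (0 : ℝ) ≤ d := Nat.cast_nonneg d
  refine ⟨fun Ω _ P _ A ρ hA => ?_, fun A ρ hA => ?_⟩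
  · have := FlowTime.le_competitive_ratio P A μ ρ hA d hdμ
    linarith
  · have := FlowTime.le_competitive_ratio _ A.toRandomized μ ρ hA.toRandomized d hdμ
    linarith
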